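/- Let $q\ge 1$ and consider $n$ qudits of local dimension $q$ with starting state $|0\rangle^{\otimes n}$. A *parameterized gate* is a gate $W_l e^{-iA\theta}W_r$ acting on at most two qudits, where $A$ is Hermitian, $W_l,W_r$ are fixed unitaries acting on the same qudits, $\theta$ is one of $p$ real parameters, and $\theta\mapsto e^{-iA\theta}$ has period $2\pi$. A *hardware-efficient ansatz* $U(\theta)$, $\theta\in[0,2\pi]^p$, is a circuit of $m$ *entangling gates* $V_1,\dots,V_m$, the $t$-th acting on a pair of distinct qudits $\{i_t,j_t\}$ and being immediately preceded and succeeded by arbitrarily many parameterized gates, each acting on one or both of the qudits $i_t,j_t$; every qudit is acted on by at least one entangling gate. The entangling gates $V_1,\dots,V_m$ are independent, and each is distributed according to a probability measure on $\mathrm U(q^2)$ that is a unitary 2-design, i.e. for which $\mathbb E[V\otimes V\otimes\bar V\otimes\bar V]$ has the same value as under the Haar probability measure. Write $\mathbb E_V$ for the expectation over them and $\mathbb E_\theta$ for the expectation over $\theta$ uniform on $[0,2\pi]^p$. Let $M_0,\dots,M_{q^2-1}\in\mathbb C^{q\times q}$ satisfy $M_0=I$ and $\mathrm{tr}(M_i^\dagger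 M_j)=q\,\delta_{i,j}$. For $\mathbf x\in\{0,\dots,q^2-1\}^n$ let $M_{\mathbf x}=M_{\mathbf x_1}\otimes\dots\otimes M_{\mathbf x_n}$, $\mathrm{supp}(\mathbf x)=\{k:\mathbf x_k\ne 0\}$ and $$g_{\mathbf x}=\mathbb E_V\,\mathbb E_\theta\,\bigl|\langle 0^n|U(\theta)^\dagger M_{\mathbf x}U(\theta)|0^n\rangle\bigr|^2 .$$ Let $(\vec\Gamma^0,\dots,\vec\Gamma^m)$ be the following biased random walk on $\{\mathtt I,\mathtt S\}^n$. In $\vec\Gamma^0$ each site independently has label $\mathtt S$ with probability $1/(q+1)$ and label $\mathtt I$ otherwise. In step $t$, if the sites $i_t,j_t$ carry equal labels, nothing changes; if they carry different labels, both become $\mathtt S$ with probability $1/(q^2+1)$ and both become $\mathtt I$ otherwise. Let $\mathrm{supp}(\vec\Gamma^m)$ be the set of sites with label $\mathtt S$ in $\vec\Gamma^m$. Then $$g_{\mathbf x}=\Pr\bigl[\mathrm{supp}(\mathbf x)\subseteq\mathrm{supp}(\vec\Gamma^m)\bigr].$$ If moreover all $M_i$ are Hermitian, then also $\mathbb E_V\,\mathbb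 E_\theta\,\langle 0^n|U(\theta)^\dagger M_{\mathbf x}U(\theta)|0^n\rangle^2=\Pr[\mathrm{supp}(\mathbf x)\subseteq\mathrm{supp}(\vec\Gamma^m)]$. -/

import Mathlib

open MeasureTheory Matrix
open scoped ENNReal

noncomputable section

namespace HEA

/-! ### The unitary group, its normalized Haar measure, and unitary 2-designs -/

section Haar

variable {ι : Type*} [Fintype ι] [DecidableEq ι]

/-- The unitary group carries its Borel σ-algebra. -/
instance : MeasurableSpace (Matrix.unitaryGroup ι ℂ) := borel _

instance : BorelSpace (Matrix.unitaryGroup ι ℂ) := ⟨rfl⟩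

/-- The unitary group is compact: it is closed and has entries of modulus at most one. -/
instance : CompactSpace (Matrix.unitaryGroup ι ℂ) := by
  refine (isCompact_iff_compactSpace (s := (Matrix.unitaryGroup ι ℂ : Set (Matrix ι ι ℂ)))).mp ?_
  have hK : IsCompact (Set.pi Set.univ fun _ : ι => Set.pi Set.univ fun _ : ι =>
      Metric.closedBall (0 : ℂ) 1) :=
    isCompact_univ_pi fun _ => isCompact_univ_pi fun _ => isCompact_closedBall _ _
  refine IsCompact.of_isClosed_subset (s := (Set.pi Set.univ fun _ : ι =>
    Set.pi Set.univ fun _ : ι => Metric.closedBall (0 : ℂ) 1)) hK ?_ ?_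
  · have h : ((Matrix.unitaryGroup ι ℂ : Set (Matrix ι ι ℂ))) = {A | A * star A = 1} := by
      ext A
      exact Matrix.mem_unitaryGroup_iff
    rw [h]
    exact isClosed_eq (by fun_prop) continuous_const
  · intro A hA i _ j _
    simpa using entry_norm_bound_of_unitary hA i j

/-- The Haar probability measure on the unitary group. -/
def unitaryHaar (ι : Type*) [Fintype ι] [DecidableEq ι] : Measure (Matrix.unitaryGroup ι ℂ) :=
  Measure.haarMeasure ⊤

/-- `μ` is a unitary 2-design: its average of `V ⊗ V ⊗ conj V ⊗ conj V` is, entry by entry,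
the average under the Haar probability measure. -/
def IsTwoDesign (μ : Measure (Matrix.unitaryGroup ι ℂ)) : Prop :=
  ∀ a b c d a' b' c' d' : ι,
    ∫ V, V.1 a b * V.1 c d * star (V.1 a' b') * star (V.1 c' d') ∂μ =
      ∫ V, V.1 a b * V.1 c d * star (V.1 a' b') * star (V.1 c' d') ∂(unitaryHaar ι)

end Haar

/-! ### Operators on `n` qudits of dimension `q` -/

/-- Operators on two qudits. -/
abbrev PairOp (q : ℕ) := Matrix (Fin q × Fin q) (Fin q × Fin q) ℂ

/-- Operators on `n` qudits, in the computational basis indexed by strings in `[q]ⁿ`. -/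
abbrev Op (n q : ℕ) := Matrix (Fin n → Fin q) (Fin n → Fin q) ℂ

/-- The operator that acts as `A` on the ordered pair of sites `(i, j)` and as the identity on all
other sites. -/
def onPair {n q : ℕ} (i j : Fin n) (A : PairOp q) : Op n q :=
  Matrix.of fun s t => if ∀ k, k ≠ i → k ≠ j → s k = t k then A (s i, s j) (t i, t j) else 0

/-- The tensor product `B 0 ⊗ ⋯ ⊗ B (n - 1)` of one-site operators. -/
def tensor {n q : ℕ} (B : Fin n → Matrix (Fin q) (Fin q) ℂ) : Op n q :=
  Matrix.of fun s t => ∏ k, B k (s k) (t k)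

/-- `⟨0ⁿ| X |0ⁿ⟩`. -/
def zeroExpectation {n q : ℕ} [NeZero q] (X : Op n q) : ℂ := X (fun _ => 0) (fun _ => 0)

/-- The family `M` is an orthogonal basis of the `q × q` matrices for the Hilbert–Schmidt inner
product, with `M 0 = 1` and normalization `tr (Mᵢ† Mⱼ) = q δᵢⱼ`. -/
structure IsOperatorBasis {q : ℕ} [NeZero q] (M : Fin (q ^ 2) → Matrix (Fin q) (Fin q) ℂ) :
    Prop where
  zero : M 0 = 1
  trace : ∀ i j, ((M i)ᴴ * M j).trace = if i = j then (q : ℂ) else 0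

/-- The support of a string of basis labels. -/
def supp {n q : ℕ} [NeZero q] (x : Fin n → Fin (q ^ 2)) : Set (Fin n) := {k | x k ≠ 0}

/-! ### The circuit model -/

/-- A parameterized gate `W_l exp(-i A θ) W_r` on (at most) two qudits, `2π`-periodic in its
parameter `θ`, which is the coordinate `param` of the vector of the `p` parameters. -/
structure ParamGate (q p : ℕ) where
  A : PairOp q
  hermitian : A.IsHermitian
  Wl : Matrix.unitaryGroup (Fin q × Fin q) ℂ
  Wr : Matrix.unitaryGroup (Fin q × Fin q) ℂ
  param : Fin p
  periodic : Function.Periodic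
    (fun θ : ℝ => NormedSpace.exp ((-(Complex.I * (θ : ℂ))) • A)) (2 * Real.pi)

/-- The unitary of a parameterized gate. -/
def ParamGate.toOp {q p : ℕ} (G : ParamGate q p) (θ : Fin p → ℝ) : PairOp q :=
  G.Wl.1 * NormedSpace.exp ((-(Complex.I * (θ G.param : ℂ))) • G.A) * G.Wr.1

/-- The product of operators listed in the order of time: later ones stand to the left. -/
def timeOrdered {α : Type*} [Monoid α] (l : List α) : α := l.reverse.prod

/-- One entangling gate, on two distinct sites `i` and `j`, with the parameterized gates that
precede and succeed it; these act on one or both of the sites `i` and `j`. -/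
structure Block (n q p : ℕ) where
  i : Fin n
  j : Fin n
  ne : i ≠ j
  pre : List (ParamGate q p)
  post : List (ParamGate q p)

/-- The operator of a block, when the entangling gate is realized by `V`. -/
def Block.toOp {n q p : ℕ} (B : Block n q p) (V : Matrix.unitaryGroup (Fin q × Fin q) ℂ)
    (θ : Fin p → ℝ) : Op n q :=
  timeOrdered (B.post.map fun G => onPair B.i B.j (G.toOp θ)) *
    onPair B.i B.j V.1 *
    timeOrdered (B.pre.map fun G => onPair B.i B.j (G.toOp θ))

/-- A hardware-efficient ansatz on `n` qudits of dimension `q` with `p` parameters and `m`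
entangling gates, in which every qudit is acted on by some entangling gate. -/
structure Circuit (n q p m : ℕ) where
  block : Fin m → Block n q p
  covers : ∀ k : Fin n, ∃ t : Fin m, k = (block t).i ∨ k = (block t).j

/-- The unitary `U_V(θ)` for the realization `V` of the entangling gates. -/
def Circuit.toOp {n q p m : ℕ} (C : Circuit n q p m)
    (V : Fin m → Matrix.unitaryGroup (Fin q × Fin q) ℂ) (θ : Fin p → ℝ) : Op n q :=
  timeOrdered (List.ofFn fun t => (C.block t).toOp (V t) θ)

/-- The pairs of sites on which the successive entangling gates act; this is all that the circuit
without its parameterized gates retains for the random walk. -/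
def Circuit.pairs {n q p m : ℕ} (C : Circuit n q p m) (t : Fin m) : Fin n × Fin n :=
  ((C.block t).i, (C.block t).j)

/-- `⟨0ⁿ| U_V(θ)† X U_V(θ) |0ⁿ⟩`. -/
def Circuit.expval {n q p m : ℕ} [NeZero q] (C : Circuit n q p m) (X : Op n q)
    (V : Fin m → Matrix.unitaryGroup (Fin q × Fin q) ℂ) (θ : Fin p → ℝ) : ℂ :=
  zeroExpectation ((C.toOp V θ)ᴴ * X * C.toOp V θ)

/-- The uniform distribution on the feasible set `[0, 2π]ᵖ`. -/
def uniformParams (p : ℕ) : Measure (Fin p → ℝ) :=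
  ProbabilityTheory.cond volume (Set.Icc 0 fun _ => 2 * Real.pi)

/-- `E_V E_θ F(V, θ)`: the entangling gates are independent, the `t`-th one with law `μ t`, and
`θ` is uniform on `[0, 2π]ᵖ`. -/
def average {q p m : ℕ} {E : Type*} [NormedAddCommGroup E] [NormedSpace ℝ E]
    (μ : Fin m → Measure (Matrix.unitaryGroup (Fin q × Fin q) ℂ))
    (F : (Fin m → Matrix.unitaryGroup (Fin q × Fin q) ℂ) → (Fin p → ℝ) → E) : E :=
  ∫ V, ∫ θ, F V θ ∂(uniformParams p) ∂(Measure.pi μ)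

/-! ### The biased random walk -/

/-- The two labels. -/
inductive Label
  | I
  | S
  deriving DecidableEq

instance : Fintype Label := ⟨{Label.I, Label.S}, fun l => by cases l <;> simp⟩

/-- The law of a label which is `S` with probability `1 / (d + 1)` and `I` otherwise. -/
def labelLaw (d : ℕ) : PMF Label :=
  PMF.ofFintype (fun l => match l with
    | Label.S => 1 / ((d : ℝ≥0∞) + 1)
    | Label.I => (d : ℝ≥0∞) / ((d : ℝ≥0∞) + 1)) (by
    have h : (Finset.univ : Finset Label) = {Label.I, Label.S} := rfl
    rw [h, Finset.sum_pair (by decide), ENNReal.div_add_div_same]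
    exact ENNReal.div_self (by simp) (by simp))

/-- The law of the initial configuration: each site is independently `S` with probability
`1 / (q + 1)` and `I` otherwise. -/
def initialLaw (n q : ℕ) : PMF (Fin n → Label) :=
  PMF.ofFintype (fun c => ∏ k, labelLaw q (c k)) (by
    have h := Finset.prod_univ_sum (fun _ : Fin n => (Finset.univ : Finset Label))
      (fun _ l => labelLaw q l)
    rw [Fintype.piFinset_univ] at h
    rw [← h]
    have h1 : ∑ l, labelLaw q l = 1 := by
      rw [← tsum_fintype (L := .unconditional _)]
      exact (labelLaw q).tsum_coe
    simp [h1])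

/-- The action of a gate on the pair of sites `e`: equal labels are left unchanged; different
labels both become `S` with probability `1 / (q² + 1)` and both become `I` otherwise. -/
def gateStep {n : ℕ} (q : ℕ) (e : Fin n × Fin n) (c : Fin n → Label) : PMF (Fin n → Label) :=
  if c e.1 = c e.2 then PMF.pure c
  else (labelLaw (q ^ 2)).map fun l => Function.update (Function.update c e.1 l) e.2 l

/-- The law of the trajectory `(Γ⁰, …, Γᵐ)` of the biased random walk whose `t`-th gate acts on
the pair of sites `e t`. -/
def biasedWalk (n q : ℕ) : (m : ℕ) → (Fin m → Fin n × Fin n) → PMF (Fin (m + 1) → Fin n → Label)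
  | 0, _ => (initialLaw n q).map fun c _ => c
  | m + 1, e => (biasedWalk n q m fun t => e t.castSucc).bind fun γ =>
      (gateStep q (e (Fin.last m)) (γ (Fin.last m))).map fun c =>
        Fin.snoc (α := fun _ => Fin n → Label) γ c

/-- The set of sites with label `S`. -/
def sSites {n : ℕ} (c : Fin n → Label) : Set (Fin n) := {k | c k = Label.S}

/-- `Pr[supp x ⊆ supp Γᵐ]` in the biased random walk associated with the circuit. -/
def Circuit.walkProb {n q p m : ℕ} [NeZero q] (C : Circuit n q p m)
    (x : Fin n → Fin (q ^ 2)) : ℝ :=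
  ((biasedWalk n q m C.pairs).toOuterMeasure {γ | supp x ⊆ sSites (γ (Fin.last m))}).toReal

end HEA

end

open scoped Kronecker

namespace HEA

/-! ### The swap operator and the commutant of `W ⊗ W` -/

section Commutant

variable {ι : Type*} [DecidableEq ι]

/-! The squared modulus of an expectation value is linear on two copies: it is the `(0,0)` entry of
`(U ⊗ U)† (X ⊗ X†) (U ⊗ U)`, and for `X = M_x` the middle operator is a product over the sites of
operators `B k` on two copies of site `k`. In the Heisenberg picture the last block acts first. Its
average over a 2-design projects the two-copy operator of the pair onto the commutant of all `W ⊗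
W`, which is spanned by `1` and the swap `F` (`exists_eq_of_commute`). Hence `B i`, `B j` are
replaced by `α (1, 1) + β (F, F)`, where `α, β` satisfy two trace equations
(`IsTwoDesign.exists_integral_onPair`). The parameterized gates of the block preserve both traces
and fix `1` and `F`, so they have no effect: the average over `V` is the same for every `θ`.

The walk is dual to this evolution. Pair `B` with the trace-one operators `1/q²` for label `I` and
`F/q` for label `S` (`siteWeight`), and multiply over the sites to get a function of configurations.
One step of the walk acts on these functions exactly as the averaged gate acts on product operators
(`pmfExpect_gateStep`). The initial law encodes the state: the `(0,0)` entry of `1` or `F` is the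
mean of its weights under the law of one label. Since every site is covered, only `1` and `F` are
left at the end, so induction on the gates (`integral_blocksOp`) writes the moment as the
expectation over the walk of the product of the weights of `M ⊗ M†`. By orthogonality that product
is the indicator of the event (`IsOperatorBasis.prod_siteWeight`). -/

/-- The operator on two copies of a space that exchanges the copies. -/
noncomputable def swapOp (ι : Type*) [DecidableEq ι] : Matrix (ι × ι) (ι × ι) ℂ :=
  Equiv.Perm.permMatrix ℂ (Equiv.prodComm ι ι)

theorem swapOp_apply (s t : ι × ι) : swapOp ι s t = if s.swap = t then 1 else 0 := by
  simp [swapOp, Equiv.Perm.permMatrix, PEquiv.toMatrix_apply, Equiv.toPEquiv_apply, eq_comm]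

variable [Fintype ι]

theorem swapOp_mul (A : Matrix (ι × ι) (ι × ι) ℂ) :
    swapOp ι * A = A.submatrix Prod.swap id := by
  ext s t
  simp [Matrix.mul_apply, swapOp_apply]

theorem mul_swapOp (A : Matrix (ι × ι) (ι × ι) ℂ) :
    A * swapOp ι = A.submatrix id Prod.swap := by
  ext s t
  simp [Matrix.mul_apply, swapOp_apply, Prod.swap_eq_iff_eq_swap]

theorem swapOp_mul_self : swapOp ι * swapOp ι = 1 := by
  rw [swapOp_mul]
  ext s t
  simp [swapOp_apply, Matrix.one_apply]

theorem trace_swapOp : (swapOp ι).trace = Fintype.card ι := by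
  rw [Matrix.trace, Fintype.sum_prod_type]
  have h : ∀ x y : ι, swapOp ι (x, y) (x, y) = if x = y then 1 else 0 := by
    intro x y
    rw [swapOp_apply]
    congr 1
    simp [eq_comm]
  simp [Matrix.diag_apply, h]

theorem kronecker_mul_swapOp (A B : Matrix ι ι ℂ) :
    (A ⊗ₖ B) * swapOp ι = swapOp ι * (B ⊗ₖ A) := by
  rw [mul_swapOp, swapOp_mul]
  ext s t
  simp [mul_comm]

/-- The swap trick; it turns the second trace invariant of `M ⊗ M†` into a Hilbert–Schmidt norm. -/
theorem trace_swapOp_mul_kronecker (A B : Matrix ι ι ℂ) :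
    (swapOp ι * (A ⊗ₖ B)).trace = (A * B).trace := by
  rw [swapOp_mul]
  simp [Matrix.trace, Matrix.mul_apply, Fintype.sum_prod_type]
  rw [Finset.sum_comm]

/-- A phase on one basis vector. -/
theorem diagonal_phase_mem (a : ι) :
    Matrix.diagonal (Function.update (1 : ι → ℂ) a Complex.I) ∈ Matrix.unitaryGroup ι ℂ := by
  rw [Matrix.mem_unitaryGroup_iff, Matrix.star_eq_conjTranspose, Matrix.diagonal_conjTranspose,
    Matrix.diagonal_mul_diagonal, ← Matrix.diagonal_one]
  congr 1
  funext k
  by_cases h : k = a <;> simp [h]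

theorem permMatrix_mem (σ : Equiv.Perm ι) : σ.permMatrix ℂ ∈ Matrix.unitaryGroup ι ℂ := by
  rw [Matrix.mem_unitaryGroup_iff, Matrix.star_eq_conjTranspose, Matrix.conjTranspose_permMatrix,
    ← Matrix.permMatrix_mul]
  simp

/-- The reflection along `e a + 2 e b`. -/
noncomputable def reflection (a b : ι) : Matrix ι ι ℂ :=
  1 - (2 / 5 : ℂ) • Matrix.vecMulVec (Pi.single a 1 + Pi.single b 2) (Pi.single a 1 + Pi.single b 2)

theorem reflection_mem {a b : ι} (h : a ≠ b) : reflection a b ∈ Matrix.unitaryGroup ι ℂ := by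
  set u : ι → ℂ := Pi.single a 1 + Pi.single b 2 with hu
  have hs : star u = u := by
    funext k
    simp only [hu, Pi.star_apply, Pi.add_apply, Pi.single_apply]
    split_ifs <;> simp
  have hd : u ⬝ᵥ u = 5 := by
    simp [hu, h, h.symm]
    norm_num
  have hstar : star (reflection a b) = reflection a b := by
    simp only [reflection, ← hu, star_sub, star_one, star_smul, Matrix.star_eq_conjTranspose,
      Matrix.conjTranspose_vecMulVec, hs]
    simp
  rw [Matrix.mem_unitaryGroup_iff, hstar]
  simp only [reflection, ← hu, sub_mul, mul_sub, one_mul, mul_one, smul_mul_assoc, mul_smul_comm,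
    Matrix.vecMulVec_mul_vecMulVec, hd]
  ext s t
  simp [Matrix.vecMulVec_apply]
  ring

variable {Z : Matrix (ι × ι) (ι × ι) ℂ}

/-- Commuting with `W ⊗ W` for diagonal unitaries. -/
theorem eq_or_eq_of_commute
    (hZ : ∀ W ∈ Matrix.unitaryGroup ι ℂ, (W ⊗ₖ W) * Z = Z * (W ⊗ₖ W)) {s t : ι × ι}
    (h : Z s t ≠ 0) : t = s ∨ t = s.swap := by
  have key : ∀ a, Function.update (1 : ι → ℂ) a Complex.I s.1 *
      Function.update (1 : ι → ℂ) a Complex.I s.2 =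
      Function.update (1 : ι → ℂ) a Complex.I t.1 *
      Function.update (1 : ι → ℂ) a Complex.I t.2 := by
    intro a
    have h1 := congrFun (congrFun (hZ _ (diagonal_phase_mem a)) s) t
    rw [Matrix.diagonal_kronecker_diagonal, Matrix.diagonal_mul, Matrix.mul_diagonal,
      mul_comm] at h1
    exact mul_left_cancel₀ h h1
  have hI : Complex.I ≠ 1 := fun h => by simpa using congrArg Complex.re h
  obtain ⟨x, x'⟩ := s
  obtain ⟨y, y'⟩ := t
  have hx := key x
  have hx' := key x'
  simp only [Function.update_apply, Pi.one_apply] at hx hx'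
  simp only [Prod.swap_prod_mk, Prod.mk.injEq]
  -- The values `1`, `i`, `i²` are distinct, so the phase at `a` counts how often `a` occurs in a
  -- pair; `s` and `t` then agree up to order.
  have hII : Complex.I * Complex.I ≠ 1 := by rw [Complex.I_mul_I]; norm_num
  have hII' : Complex.I * Complex.I ≠ Complex.I := by
    rw [Complex.I_mul_I]; exact fun h => by simpa using congrArg Complex.re h
  grind

theorem apply_perm_of_commute
    (hZ : ∀ W ∈ Matrix.unitaryGroup ι ℂ, (W ⊗ₖ W) * Z = Z * (W ⊗ₖ W)) (σ : Equiv.Perm ι)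
    (x x' y y' : ι) : Z (σ x, σ x') (σ y, σ y') = Z (x, x') (y, y') := by
  have h1 := congrFun (congrFun (hZ _ (permMatrix_mem σ)) (x, x')) (σ y, σ y')
  simpa [Matrix.mul_apply, Fintype.sum_prod_type, Equiv.Perm.permMatrix, PEquiv.toMatrix_apply,
    Equiv.toPEquiv_apply, ← ite_and, Finset.sum_ite_eq, ite_and] using h1

theorem diag_eq_of_commute
    (hZ : ∀ W ∈ Matrix.unitaryGroup ι ℂ, (W ⊗ₖ W) * Z = Z * (W ⊗ₖ W)) {a b : ι} (hab : a ≠ b) :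
    Z (a, a) (a, a) = Z (a, b) (a, b) + Z (a, b) (b, a) := by
  -- By the phase argument only `(a, b)`, `(b, a)` contribute on the left and `(a, a)` on the right.
  -- All these terms carry the factor `W a a * W a b = (3/5)(-4/5) = -12/25`, which is cancelled at
  -- the end.
  have h1 := congrFun (congrFun (hZ _ (reflection_mem hab)) (a, a)) (a, b)
  rw [Matrix.mul_apply, Matrix.mul_apply,
    ← Finset.sum_subset (Finset.subset_univ {(a, b), (b, a)}),
    ← Finset.sum_subset (Finset.subset_univ {(a, a)})] at h1
  · have h2 := apply_perm_of_commute hZ (Equiv.swap a b) a b b a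
    simp only [Equiv.swap_apply_left, Equiv.swap_apply_right] at h2
    rw [Finset.sum_pair (by simp [hab]), Finset.sum_singleton] at h1
    simp [reflection, Matrix.vecMulVec_apply, hab, hab.symm] at h1
    rw [h2] at h1
    linear_combination (25 / 12 : ℂ) * h1
  · intro t _ ht
    by_contra hne
    rcases eq_or_eq_of_commute hZ (left_ne_zero_of_mul hne) with h | h <;> simp [h] at ht
  · intro t _ ht
    by_contra hne
    rcases eq_or_eq_of_commute hZ (right_ne_zero_of_mul hne) with h | h
    · simp [← h] at ht
    · have := congrArg Prod.swap h
      simp only [Prod.swap_prod_mk, Prod.swap_swap] at this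
      simp [← this] at ht

/-- An operator that commutes with all `W ⊗ W` is a combination of the identity and the swap. -/
theorem exists_eq_of_commute
    (hZ : ∀ W ∈ Matrix.unitaryGroup ι ℂ, (W ⊗ₖ W) * Z = Z * (W ⊗ₖ W)) :
    ∃ α β : ℂ, Z = α • 1 + β • swapOp ι := by
  rcases subsingleton_or_nontrivial ι with hι | hι
  · rcases isEmpty_or_nonempty ι with he | ⟨⟨a⟩⟩
    · exact ⟨0, 0, by ext s; exact he.elim s.1⟩
    -- In dimension one the swap is the identity, so the coefficients are not unique.
    · refine ⟨Z (a, a) (a, a), 0, ?_⟩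
      ext s t
      rw [Subsingleton.elim s (a, a), Subsingleton.elim t (a, a)]
      simp
  · obtain ⟨a, b, hab⟩ := exists_pair_ne ι
    have hdiff : ∀ x y, x ≠ y → Z (x, y) (x, y) = Z (a, b) (a, b) ∧
        Z (x, y) (y, x) = Z (a, b) (b, a) := by
      intro x y hxy
      -- Permutations are 2-transitive, so the entries of `Z` at distinct pairs are two constants;
      -- the diagonal ones follow from `diag_eq_of_commute`.
      have := Equiv.Perm.isMultiplyPretransitive ι 2
      rw [MulAction.is_two_pretransitive_iff] at this
      obtain ⟨σ, rfl, rfl⟩ := this hab hxy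
      exact ⟨apply_perm_of_commute hZ σ _ _ _ _, apply_perm_of_commute hZ σ _ _ _ _⟩
    refine ⟨Z (a, b) (a, b), Z (a, b) (b, a), ?_⟩
    ext ⟨x, x'⟩ ⟨y, y'⟩
    by_cases h0 : Z (x, x') (y, y') = 0
    · rw [h0]
      by_cases hx : x = x'
      · subst hx
        obtain ⟨w, hw⟩ := exists_ne x
        have h1 := diag_eq_of_commute hZ hw.symm
        rw [(hdiff _ _ hw.symm).1, (hdiff _ _ hw.symm).2] at h1
        by_cases h2 : y = x ∧ y' = x
        · obtain ⟨rfl, rfl⟩ := h2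
          simp [swapOp_apply, ← h1, h0]
        · have h3 : (x, x) ≠ (y, y') := by
            rw [Ne, Prod.mk.injEq]; exact fun h => h2 ⟨h.1.symm, h.2.symm⟩
          simp [swapOp_apply, Matrix.one_apply_ne h3, h3]
      · by_cases h2 : y = x ∧ y' = x'
        · obtain ⟨rfl, rfl⟩ := h2
          have := (hdiff _ _ hx).1
          rw [h0] at this
          simp [swapOp_apply, ← this, Ne.symm hx]
        · by_cases h3 : y = x' ∧ y' = x
          · obtain ⟨rfl, rfl⟩ := h3
            have := (hdiff _ _ hx).2
            rw [h0] at this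
            simp [← this, hx]
          · have h4 : (x, x') ≠ (y, y') := by
              rw [Ne, Prod.mk.injEq]; exact fun h => h2 ⟨h.1.symm, h.2.symm⟩
            have h5 : (x', x) ≠ (y, y') := by
              rw [Ne, Prod.mk.injEq]; exact fun h => h3 ⟨h.1.symm, h.2.symm⟩
            simp [swapOp_apply, Matrix.one_apply_ne h4, h5]
    · by_cases hx : x = x'
      · subst hx
        obtain ⟨w, hw⟩ := exists_ne x
        have h1 := diag_eq_of_commute hZ hw.symm
        rw [(hdiff _ _ hw.symm).1, (hdiff _ _ hw.symm).2] at h1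
        rcases eq_or_eq_of_commute hZ h0 with h | h <;>
        · simp only [Prod.swap_prod_mk, Prod.mk.injEq] at h
          obtain ⟨rfl, rfl⟩ := h
          simp [swapOp_apply, ← h1]
      · rcases eq_or_eq_of_commute hZ h0 with h | h <;>
        · simp only [Prod.swap_prod_mk, Prod.mk.injEq] at h
          obtain ⟨rfl, rfl⟩ := h
          simp [swapOp_apply, hdiff _ _ hx, hx, Ne.symm hx]

end Commutant

/-! ### Second moments of a unitary 2-design -/

section Twirl

variable {ι : Type*} [Fintype ι] [DecidableEq ι]

instance : SecondCountableTopology (Matrix ι ι ℂ) :=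
  inferInstanceAs (SecondCountableTopology (ι → ι → ℂ))

instance : SecondCountableTopology (Matrix.unitaryGroup ι ℂ) :=
  inferInstanceAs (SecondCountableTopology
    ((Matrix.unitaryGroup ι ℂ : Set (Matrix ι ι ℂ)) : Type _))

instance : (unitaryHaar ι).IsHaarMeasure := by
  unfold unitaryHaar
  infer_instance

instance : IsProbabilityMeasure (unitaryHaar ι) :=
  ⟨Measure.haarMeasure_self (K₀ := ⊤)⟩

/-- A right translate of Haar measure is again a Haar probability measure, and there is only one. -/
instance : (unitaryHaar ι).IsMulRightInvariant where
  map_mul_right_eq_self g := by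
    have : IsProbabilityMeasure ((unitaryHaar ι).map (· * g)) :=
      Measure.isProbabilityMeasure_map (measurable_mul_const g).aemeasurable
    exact Measure.isHaarMeasure_eq_of_isProbabilityMeasure _ _

theorem integrable_of_continuous {X : Type*} [TopologicalSpace X] [CompactSpace X]
    [MeasurableSpace X] [OpensMeasurableSpace X] (ν : Measure X) [IsFiniteMeasure ν]
    {f : X → ℂ} (hf : Continuous f) : Integrable f ν :=
  hf.integrable_of_hasCompactSupport (HasCompactSupport.of_compactSpace f)

theorem map_eq_sum_entries (L : Matrix ι ι ℂ →ₗ[ℂ] ℂ) (A : Matrix ι ι ℂ) :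
    L A = ∑ s, ∑ t, A s t * L (Matrix.single s t 1) := by
  conv_lhs => rw [Matrix.matrix_eq_sum_single A]
  simp only [map_sum]
  refine Finset.sum_congr rfl fun s _ => Finset.sum_congr rfl fun t _ => ?_
  rw [← smul_eq_mul, ← map_smul, Matrix.smul_single, smul_eq_mul, mul_one]

/-- A functional is a finite combination of entries, so entrywise integrals suffice and no norm on
matrices is chosen. -/
theorem integral_linearMap {X : Type*} [MeasurableSpace X] (ν : Measure X)
    {F : X → Matrix ι ι ℂ} (hF : ∀ s t, Integrable (fun x => F x s t) ν)
    (L : Matrix ι ι ℂ →ₗ[ℂ] ℂ) :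
    ∫ x, L (F x) ∂ν = L (Matrix.of fun s t => ∫ x, F x s t ∂ν) := by
  simp_rw [fun x => map_eq_sum_entries L (F x)]
  rw [map_eq_sum_entries L (Matrix.of _), integral_finsetSum _ fun s _ => integrable_finsetSum _ fun t _ => (hF s t).mul_const _]
  refine Finset.sum_congr rfl fun s _ => ?_
  rw [integral_finsetSum _ fun t _ => (hF s t).mul_const _]
  refine Finset.sum_congr rfl fun t _ => ?_
  rw [integral_mul_const, Matrix.of_apply]

/-- `Y ↦ (U ⊗ U)† Y (U ⊗ U)`. -/
noncomputable def conjCopies (U : Matrix ι ι ℂ) :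
    Matrix (ι × ι) (ι × ι) ℂ →ₗ[ℂ] Matrix (ι × ι) (ι × ι) ℂ :=
  LinearMap.mulRight ℂ (U ⊗ₖ U) ∘ₗ LinearMap.mulLeft ℂ (U ⊗ₖ U)ᴴ

theorem conjCopies_apply (U : Matrix ι ι ℂ) (Y : Matrix (ι × ι) (ι × ι) ℂ) :
    conjCopies U Y = (U ⊗ₖ U)ᴴ * Y * (U ⊗ₖ U) := rfl

theorem conjCopies_mul (A B : Matrix ι ι ℂ) (Y : Matrix (ι × ι) (ι × ι) ℂ) :
    conjCopies (A * B) Y = conjCopies B (conjCopies A Y) := by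
  simp only [conjCopies_apply, Matrix.mul_kronecker_mul, Matrix.conjTranspose_mul, Matrix.mul_assoc]

theorem conjCopies_kronecker (U A B : Matrix ι ι ℂ) :
    conjCopies U (A ⊗ₖ B) = (Uᴴ * A * U) ⊗ₖ (Uᴴ * B * U) := by
  simp only [conjCopies_apply, Matrix.mul_kronecker_mul, Matrix.conjTranspose_kronecker]

theorem kronecker_self_mul_conjTranspose {U : Matrix ι ι ℂ} (hU : U ∈ Matrix.unitaryGroup ι ℂ) :
    (U ⊗ₖ U) * (U ⊗ₖ U)ᴴ = 1 :=
  Matrix.mem_unitaryGroup_iff.mp (Matrix.kronecker_mem_unitary hU hU)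

theorem conjTranspose_mul_kronecker_self {U : Matrix ι ι ℂ} (hU : U ∈ Matrix.unitaryGroup ι ℂ) :
    (U ⊗ₖ U)ᴴ * (U ⊗ₖ U) = 1 :=
  Matrix.mem_unitaryGroup_iff'.mp (Matrix.kronecker_mem_unitary hU hU)

theorem conjCopies_one {U : Matrix ι ι ℂ} (hU : U ∈ Matrix.unitaryGroup ι ℂ) :
    conjCopies U 1 = 1 := by
  rw [conjCopies_apply, mul_one, conjTranspose_mul_kronecker_self hU]

theorem swapOp_mul_conjCopies (U : Matrix ι ι ℂ) (Y : Matrix (ι × ι) (ι × ι) ℂ) :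
    swapOp ι * conjCopies U Y = conjCopies U (swapOp ι * Y) := by
  simp only [conjCopies_apply, Matrix.conjTranspose_kronecker, ← mul_assoc, kronecker_mul_swapOp]

theorem conjCopies_swapOp {U : Matrix ι ι ℂ} (hU : U ∈ Matrix.unitaryGroup ι ℂ) :
    conjCopies U (swapOp ι) = swapOp ι := by
  have h := swapOp_mul_conjCopies U 1
  rw [conjCopies_one hU, mul_one] at h
  exact h.symm

theorem trace_conjCopies {U : Matrix ι ι ℂ} (hU : U ∈ Matrix.unitaryGroup ι ℂ)
    (Y : Matrix (ι × ι) (ι × ι) ℂ) : (conjCopies U Y).trace = Y.trace := by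
  rw [conjCopies_apply, Matrix.trace_mul_cycle, kronecker_self_mul_conjTranspose hU, one_mul]

theorem trace_swapOp_mul_conjCopies {U : Matrix ι ι ℂ} (hU : U ∈ Matrix.unitaryGroup ι ℂ)
    (Y : Matrix (ι × ι) (ι × ι) ℂ) :
    (swapOp ι * conjCopies U Y).trace = (swapOp ι * Y).trace := by
  rw [swapOp_mul_conjCopies, trace_conjCopies hU]

/-- The monomials that appear are those whose averages `IsTwoDesign` prescribes. -/
theorem conjCopies_entry (U : Matrix ι ι ℂ) (Y : Matrix (ι × ι) (ι × ι) ℂ) (s t : ι × ι) :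
    conjCopies U Y s t = ∑ y, ∑ x, U y.1 t.1 * U y.2 t.2 * star (U x.1 s.1) * star (U x.2 s.2) *
      Y x y := by
  simp only [conjCopies_apply, Matrix.mul_apply, Matrix.conjTranspose_apply, Finset.sum_mul,
    Matrix.kroneckerMap_apply, star_mul']
  refine Finset.sum_congr rfl fun y _ => Finset.sum_congr rfl fun x _ => ?_
  ring

theorem continuous_entry (a b : ι) : Continuous fun V : Matrix.unitaryGroup ι ℂ => V.1 a b :=
  continuous_subtype_val.matrix_elem a b

theorem continuous_conjCopies_entry (Y : Matrix (ι × ι) (ι × ι) ℂ) (s t : ι × ι) :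
    Continuous fun V : Matrix.unitaryGroup ι ℂ => conjCopies V.1 Y s t := by
  simp only [conjCopies_entry]
  refine continuous_finsetSum _ fun y _ => continuous_finsetSum _ fun x _ => ?_
  exact ((((continuous_entry _ _).mul (continuous_entry _ _)).mul
    (continuous_entry _ _).star).mul (continuous_entry _ _).star).mul continuous_const

theorem IsTwoDesign.integral_conjCopies_entry {μ : Measure (Matrix.unitaryGroup ι ℂ)}
    [IsProbabilityMeasure μ] (hμ : IsTwoDesign μ) (Y : Matrix (ι × ι) (ι × ι) ℂ) (s t : ι × ι) :
    ∫ V, conjCopies V.1 Y s t ∂μ = ∫ V, conjCopies V.1 Y s t ∂(unitaryHaar ι) := by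
  have hc : ∀ x y : ι × ι, Continuous fun V : Matrix.unitaryGroup ι ℂ =>
      V.1 y.1 t.1 * V.1 y.2 t.2 * star (V.1 x.1 s.1) * star (V.1 x.2 s.2) := fun x y =>
    (((continuous_entry _ _).mul (continuous_entry _ _)).mul
      (continuous_entry _ _).star).mul (continuous_entry _ _).star
  have hexp : ∀ (ν : Measure (Matrix.unitaryGroup ι ℂ)) [IsProbabilityMeasure ν],
      ∫ V, conjCopies V.1 Y s t ∂ν = ∑ y, ∑ x,
        (∫ V, V.1 y.1 t.1 * V.1 y.2 t.2 * star (V.1 x.1 s.1) * star (V.1 x.2 s.2) ∂ν) * Y x y := by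
    intro ν _
    have hi : ∀ x y : ι × ι, Integrable (fun V : Matrix.unitaryGroup ι ℂ =>
        V.1 y.1 t.1 * V.1 y.2 t.2 * star (V.1 x.1 s.1) * star (V.1 x.2 s.2) * Y x y) ν :=
      fun x y => (integrable_of_continuous ν (hc x y)).mul_const _
    simp only [conjCopies_entry]
    rw [integral_finsetSum _ fun y _ => integrable_finsetSum _ fun x _ => hi x y]
    refine Finset.sum_congr rfl fun y _ => ?_
    rw [integral_finsetSum _ fun x _ => hi x y]
    exact Finset.sum_congr rfl fun x _ => integral_mul_const _ _
  rw [hexp μ, hexp (unitaryHaar ι)]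
  refine Finset.sum_congr rfl fun y _ => Finset.sum_congr rfl fun x _ => ?_
  rw [hμ]

/-- The second-moment operator of a 2-design takes values in the span of the identity and the swap;
the coefficients are determined by two traces. -/
theorem IsTwoDesign.exists_integral_conjCopies {μ : Measure (Matrix.unitaryGroup ι ℂ)}
    [IsProbabilityMeasure μ] (hμ : IsTwoDesign μ) (Y : Matrix (ι × ι) (ι × ι) ℂ) :
    ∃ α β : ℂ,
      α * (Fintype.card ι : ℂ) ^ 2 + β * Fintype.card ι = Y.trace ∧
      α * Fintype.card ι + β * (Fintype.card ι : ℂ) ^ 2 = (swapOp ι * Y).trace ∧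
      ∀ L : Matrix (ι × ι) (ι × ι) ℂ →ₗ[ℂ] ℂ,
        ∫ V, L (conjCopies V.1 Y) ∂μ = α * L 1 + β * L (swapOp ι) := by
  set Z : Matrix (ι × ι) (ι × ι) ℂ :=
    Matrix.of fun s t => ∫ V, conjCopies V.1 Y s t ∂(unitaryHaar ι) with hZdef
  have hL : ∀ (L : Matrix (ι × ι) (ι × ι) ℂ →ₗ[ℂ] ℂ),
      ∫ V, L (conjCopies V.1 Y) ∂(unitaryHaar ι) = L Z := fun L =>
    integral_linearMap _ (fun s t => integrable_of_continuous _
      (continuous_conjCopies_entry Y s t)) L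
  -- Conjugating by `V` and then by `W` is conjugating by `V * W`, so this is right invariance of
  -- Haar measure.
  have hinv : ∀ W ∈ Matrix.unitaryGroup ι ℂ, conjCopies W Z = Z := by
    intro W hW
    ext s t
    have h := hL (Matrix.entryLinearMap ℂ ℂ s t ∘ₗ conjCopies W)
    simp only [LinearMap.comp_apply, Matrix.entryLinearMap_apply, ← conjCopies_mul] at h
    rw [← h]
    exact integral_mul_right_eq_self (μ := unitaryHaar ι)
      (fun V : Matrix.unitaryGroup ι ℂ => conjCopies V.1 Y s t) ⟨W, hW⟩
  have hcomm : ∀ W ∈ Matrix.unitaryGroup ι ℂ, (W ⊗ₖ W) * Z = Z * (W ⊗ₖ W) := by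
    intro W hW
    conv_lhs => rw [← hinv W hW, conjCopies_apply, ← mul_assoc, ← mul_assoc,
      kronecker_self_mul_conjTranspose hW, one_mul]
  obtain ⟨α, β, hαβ⟩ := exists_eq_of_commute hcomm
  have htr : Z.trace = Y.trace := by
    have h := hL (Matrix.traceLinearMap _ ℂ ℂ)
    simp only [Matrix.traceLinearMap_apply] at h
    rw [← h]
    simp [trace_conjCopies (SetLike.coe_mem _)]
  have htr' : (swapOp ι * Z).trace = (swapOp ι * Y).trace := by
    have h := hL (Matrix.traceLinearMap _ ℂ ℂ ∘ₗ LinearMap.mulLeft ℂ (swapOp ι))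
    simp only [LinearMap.comp_apply, Matrix.traceLinearMap_apply, LinearMap.mulLeft_apply] at h
    rw [← h]
    simp [trace_swapOp_mul_conjCopies (SetLike.coe_mem _)]
  refine ⟨α, β, ?_, ?_, fun L => ?_⟩
  · rw [← htr, hαβ, Matrix.trace_add, Matrix.trace_smul, Matrix.trace_smul, trace_swapOp,
      Matrix.trace_one, Fintype.card_prod]
    simp [sq]
  · rw [← htr', hαβ, mul_add, mul_smul_comm, mul_smul_comm, swapOp_mul_self, mul_one,
      Matrix.trace_add, Matrix.trace_smul, Matrix.trace_smul, trace_swapOp, Matrix.trace_one,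
      Fintype.card_prod]
    simp [sq]
  · rw [integral_linearMap _ (fun s t => integrable_of_continuous _
      (continuous_conjCopies_entry Y s t)) L]
    simp only [hμ.integral_conjCopies_entry]
    rw [← hZdef, hαβ]
    simp

/-- The same with fixed unitaries before and after the random one. -/
theorem IsTwoDesign.exists_integral_conjCopies_mul {μ : Measure (Matrix.unitaryGroup ι ℂ)}
    [IsProbabilityMeasure μ] (hμ : IsTwoDesign μ) {P Q : Matrix ι ι ℂ}
    (hP : P ∈ Matrix.unitaryGroup ι ℂ) (hQ : Q ∈ Matrix.unitaryGroup ι ℂ)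
    (Y : Matrix (ι × ι) (ι × ι) ℂ) :
    ∃ α β : ℂ,
      α * (Fintype.card ι : ℂ) ^ 2 + β * Fintype.card ι = Y.trace ∧
      α * Fintype.card ι + β * (Fintype.card ι : ℂ) ^ 2 = (swapOp ι * Y).trace ∧
      ∀ L : Matrix (ι × ι) (ι × ι) ℂ →ₗ[ℂ] ℂ,
        ∫ V, L (conjCopies (P * V.1 * Q) Y) ∂μ = α * L 1 + β * L (swapOp ι) := by
  -- `P` acts on `Y` before the twirl and preserves both traces; `Q` acts after it, on `1` and the
  -- swap, which it fixes.
  obtain ⟨α, β, h1, h2, h3⟩ := hμ.exists_integral_conjCopies (conjCopies P Y)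
  rw [trace_conjCopies hP] at h1
  rw [trace_swapOp_mul_conjCopies hP] at h2
  refine ⟨α, β, h1, h2, fun L => ?_⟩
  have h := h3 (L ∘ₗ conjCopies Q)
  simp only [LinearMap.comp_apply, conjCopies_one hQ, conjCopies_swapOp hQ] at h
  simpa only [conjCopies_mul] using h

end Twirl

/-! ### Gates on a pair of sites and product operators on two copies -/

section Pair

variable {n q : ℕ}

/-- Separation of the sites `i` and `j` from the other ones. -/
def splitPair (i j : Fin n) (s : Fin n → Fin q) :
    (Fin q × Fin q) × ({k : Fin n // k ≠ i ∧ k ≠ j} → Fin q) :=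
  ((s i, s j), fun k => s k)

theorem splitPair_bijective {i j : Fin n} (h : i ≠ j) :
    Function.Bijective (splitPair (q := q) i j) := by
  constructor
  · intro s t hst
    simp only [splitPair, Prod.mk.injEq] at hst
    funext k
    by_cases hi : k = i
    · rw [hi]; exact hst.1.1
    · by_cases hj : k = j
      · rw [hj]; exact hst.1.2
      · exact congrFun hst.2 ⟨k, hi, hj⟩
  · rintro ⟨⟨a, b⟩, r⟩
    refine ⟨fun k => if hi : k = i then a else if hj : k = j then b else r ⟨k, hi, hj⟩, ?_⟩
    simp only [splitPair, Prod.mk.injEq, dif_pos, dif_neg h.symm, true_and]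
    funext k
    rw [dif_neg k.2.1, dif_neg k.2.2]

theorem onPair_eq (i j : Fin n) (A : PairOp q) :
    onPair i j A = (A ⊗ₖ (1 : Matrix ({k : Fin n // k ≠ i ∧ k ≠ j} → Fin q) _ ℂ)).submatrix
      (splitPair i j) (splitPair i j) := by
  ext s t
  simp only [onPair, Matrix.of_apply, Matrix.submatrix_apply, splitPair, Matrix.kroneckerMap_apply,
    Matrix.one_apply, funext_iff, Subtype.forall, and_imp, mul_ite, mul_one, mul_zero]

theorem onPair_mul {i j : Fin n} (h : i ≠ j) (A B : PairOp q) :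
    onPair i j A * onPair i j B = onPair i j (A * B) := by
  rw [onPair_eq, onPair_eq, onPair_eq, ← Matrix.submatrix_mul _ _ _ _ _ (splitPair_bijective h),
    ← Matrix.mul_kronecker_mul, one_mul]

theorem onPair_one {i j : Fin n} (h : i ≠ j) : onPair i j (1 : PairOp q) = 1 := by
  rw [onPair_eq, Matrix.one_kronecker_one, Matrix.submatrix_one _ (splitPair_bijective h).1]

theorem onPair_conjTranspose (i j : Fin n) (A : PairOp q) :
    (onPair i j A)ᴴ = onPair i j Aᴴ := by
  rw [onPair_eq, onPair_eq, Matrix.conjTranspose_submatrix, Matrix.conjTranspose_kronecker,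
    Matrix.conjTranspose_one]

theorem onPair_mem {i j : Fin n} (h : i ≠ j) {A : PairOp q}
    (hA : A ∈ Matrix.unitaryGroup (Fin q × Fin q) ℂ) :
    onPair i j A ∈ Matrix.unitaryGroup (Fin n → Fin q) ℂ := by
  rw [Matrix.mem_unitaryGroup_iff, Matrix.star_eq_conjTranspose, onPair_conjTranspose,
    onPair_mul h, ← Matrix.star_eq_conjTranspose, Matrix.mem_unitaryGroup_iff.mp hA, onPair_one h]

/-- `splitPair` on two copies. -/
def splitCopies (i j : Fin n) (s : (Fin n → Fin q) × (Fin n → Fin q)) :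
    ((Fin q × Fin q) × (Fin q × Fin q)) ×
      (({k : Fin n // k ≠ i ∧ k ≠ j} → Fin q) × ({k : Fin n // k ≠ i ∧ k ≠ j} → Fin q)) :=
  (((splitPair i j s.1).1, (splitPair i j s.2).1), ((splitPair i j s.1).2, (splitPair i j s.2).2))

theorem splitCopies_bijective {i j : Fin n} (h : i ≠ j) :
    Function.Bijective (splitCopies (q := q) i j) :=
  (Equiv.prodProdProdComm _ _ _ _).bijective.comp
    ((splitPair_bijective h).prodMap (splitPair_bijective h))

/-- Extension of an operator on two copies of the sites `i` and `j` by an operator on two copies of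
the other sites. -/
noncomputable def extendPair (i j : Fin n)
    (R : Matrix (({k : Fin n // k ≠ i ∧ k ≠ j} → Fin q) × ({k : Fin n // k ≠ i ∧ k ≠ j} → Fin q))
      (({k : Fin n // k ≠ i ∧ k ≠ j} → Fin q) × ({k : Fin n // k ≠ i ∧ k ≠ j} → Fin q)) ℂ) :
    Matrix ((Fin q × Fin q) × (Fin q × Fin q)) ((Fin q × Fin q) × (Fin q × Fin q)) ℂ →ₗ[ℂ]
      Matrix ((Fin n → Fin q) × (Fin n → Fin q)) ((Fin n → Fin q) × (Fin n → Fin q)) ℂ where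
  toFun Y := (Y ⊗ₖ R).submatrix (splitCopies i j) (splitCopies i j)
  map_add' Y Y' := by rw [Matrix.add_kronecker]; rfl
  map_smul' c Y := by rw [Matrix.smul_kronecker]; rfl

theorem extendPair_apply (i j : Fin n) (R) (Y) :
    extendPair (q := q) i j R Y = (Y ⊗ₖ R).submatrix (splitCopies i j) (splitCopies i j) := rfl

theorem onPair_kronecker_self (i j : Fin n) (A : PairOp q) :
    onPair i j A ⊗ₖ onPair i j A = extendPair i j 1 (A ⊗ₖ A) := by
  ext s t
  rw [extendPair_apply, onPair_eq, ← Matrix.one_kronecker_one]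
  simp only [Matrix.kroneckerMap_apply, Matrix.submatrix_apply, splitCopies]
  ring

theorem extendPair_mul {i j : Fin n} (h : i ≠ j) (R R') (Y Y') :
    extendPair (q := q) i j R Y * extendPair i j R' Y' = extendPair i j (R * R') (Y * Y') := by
  simp only [extendPair_apply]
  rw [← Matrix.submatrix_mul _ _ _ _ _ (splitCopies_bijective h), ← Matrix.mul_kronecker_mul]

theorem conjCopies_onPair {i j : Fin n} (h : i ≠ j) (A : PairOp q) (R) (Y) :
    conjCopies (onPair i j A) (extendPair i j R Y) = extendPair i j R (conjCopies A Y) := by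
  have hct : (extendPair i j 1 (A ⊗ₖ A))ᴴ = extendPair i j 1 (A ⊗ₖ A)ᴴ := by
    rw [extendPair_apply, extendPair_apply, Matrix.conjTranspose_submatrix,
      Matrix.conjTranspose_kronecker _ (1 : Matrix _ _ ℂ), Matrix.conjTranspose_one]
  rw [conjCopies_apply, onPair_kronecker_self, hct, extendPair_mul h, extendPair_mul h, one_mul,
    mul_one, conjCopies_apply]

/-- The product of the operators `B k`, each of which acts on the two copies of the site `k`. -/
def tensorCopies (B : Fin n → PairOp q) :
    Matrix ((Fin n → Fin q) × (Fin n → Fin q)) ((Fin n → Fin q) × (Fin n → Fin q)) ℂ :=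
  Matrix.of fun s t => ∏ k, B k (s.1 k, s.2 k) (t.1 k, t.2 k)

theorem tensor_kronecker_tensor (X Y : Fin n → Matrix (Fin q) (Fin q) ℂ) :
    tensor X ⊗ₖ tensor Y = tensorCopies fun k => X k ⊗ₖ Y k := by
  ext s t
  simp only [Matrix.kroneckerMap_apply, tensor, tensorCopies, Matrix.of_apply,
    Finset.prod_mul_distrib]

/-- The product of an operator on two copies of one site and an operator on two copies of another
one. -/
noncomputable def pairCopies (B C : PairOp q) :
    Matrix ((Fin q × Fin q) × (Fin q × Fin q)) ((Fin q × Fin q) × (Fin q × Fin q)) ℂ :=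
  (B ⊗ₖ C).submatrix (Equiv.prodProdProdComm _ _ _ _) (Equiv.prodProdProdComm _ _ _ _)

theorem pairCopies_one : pairCopies (1 : PairOp q) 1 = 1 := by
  simp [pairCopies]

/-- Exchanging two copies of a pair exchanges the copies of each site. This is why the twirl of a
product operator is a combination of product operators. -/
theorem pairCopies_swapOp : pairCopies (swapOp (Fin q)) (swapOp (Fin q)) = swapOp _ := by
  ext ⟨⟨a, b⟩, ⟨c, d⟩⟩ ⟨⟨a', b'⟩, ⟨c', d'⟩⟩
  simp only [pairCopies, Matrix.submatrix_apply, Equiv.prodProdProdComm_apply,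
    Matrix.kroneckerMap_apply, swapOp_apply, Prod.swap_prod_mk, Prod.mk.injEq, mul_ite, mul_one,
    mul_zero, ← ite_and]
  congr 1
  grind

theorem pairCopies_mul (B C B' C' : PairOp q) :
    pairCopies B C * pairCopies B' C' = pairCopies (B * B') (C * C') := by
  rw [pairCopies, pairCopies, pairCopies, Matrix.submatrix_mul_equiv, ← Matrix.mul_kronecker_mul]

theorem trace_pairCopies (B C : PairOp q) : (pairCopies B C).trace = B.trace * C.trace := by
  rw [← Matrix.trace_kronecker, pairCopies]
  exact (Equiv.prodProdProdComm _ _ _ _).sum_comp fun s => (B ⊗ₖ C) s s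

theorem trace_swapOp_mul_pairCopies (B C : PairOp q) :
    (swapOp _ * pairCopies B C).trace = (swapOp _ * B).trace * (swapOp _ * C).trace := by
  rw [← pairCopies_swapOp, pairCopies_mul, trace_pairCopies]

/-- The part of a product operator that acts on the sites other than `i` and `j`. -/
def restCopies (i j : Fin n) (B : Fin n → PairOp q) :
    Matrix (({k : Fin n // k ≠ i ∧ k ≠ j} → Fin q) × ({k : Fin n // k ≠ i ∧ k ≠ j} → Fin q))
      (({k : Fin n // k ≠ i ∧ k ≠ j} → Fin q) × ({k : Fin n // k ≠ i ∧ k ≠ j} → Fin q)) ℂ :=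
  Matrix.of fun s t => ∏ k : {k : Fin n // k ≠ i ∧ k ≠ j}, B k (s.1 k, s.2 k) (t.1 k, t.2 k)

theorem prod_eq_mul_mul_prod_rest {R : Type*} [CommMonoid R] {i j : Fin n} (h : i ≠ j)
    (f : Fin n → R) : ∏ k, f k = f i * f j * ∏ k : {k : Fin n // k ≠ i ∧ k ≠ j}, f k := by
  rw [← Finset.prod_subtype (Finset.univ.filter fun k => k ≠ i ∧ k ≠ j) (by simp) f,
    ← Finset.prod_filter_not_mul_prod_filter Finset.univ fun k => k ≠ i ∧ k ≠ j]
  congr 1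
  have : (Finset.univ.filter fun k => ¬(k ≠ i ∧ k ≠ j)) = {i, j} := by
    ext k
    simp
    tauto
  rw [this, Finset.prod_pair h]

theorem tensorCopies_eq_extendPair {i j : Fin n} (h : i ≠ j) (B : Fin n → PairOp q) :
    tensorCopies B = extendPair i j (restCopies i j B) (pairCopies (B i) (B j)) := by
  ext s t
  simp only [tensorCopies, extendPair_apply, pairCopies, restCopies, Matrix.of_apply,
    Matrix.submatrix_apply, Matrix.kroneckerMap_apply, splitCopies, splitPair,
    Equiv.prodProdProdComm_apply]
  exact prod_eq_mul_mul_prod_rest h _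

/-- Replacement of the operators at the sites `i` and `j` by `D`. -/
def setPair {α : Type*} (i j : Fin n) (B : Fin n → α) (D : α) : Fin n → α :=
  Function.update (Function.update B i D) j D

theorem setPair_left {α : Type*} (i j : Fin n) (B : Fin n → α) (D : α) :
    setPair i j B D i = D := by
  simp [setPair, Function.update_apply]

theorem setPair_right {α : Type*} (i j : Fin n) (B : Fin n → α) (D : α) :
    setPair i j B D j = D := by
  simp [setPair]

theorem setPair_of_ne {α : Type*} {i j k : Fin n} (hi : k ≠ i) (hj : k ≠ j) (B : Fin n → α)
    (D : α) : setPair i j B D k = B k := by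
  simp [setPair, hi, hj]

theorem tensorCopies_setPair {i j : Fin n} (h : i ≠ j) (B : Fin n → PairOp q) (D : PairOp q) :
    tensorCopies (setPair i j B D) = extendPair i j (restCopies i j B) (pairCopies D D) := by
  have hrest : restCopies i j (setPair i j B D) = restCopies i j B := by
    ext s t
    simp only [restCopies, Matrix.of_apply]
    exact Finset.prod_congr rfl fun k _ => by rw [setPair_of_ne k.2.1 k.2.2]
  rw [tensorCopies_eq_extendPair h, setPair_left, setPair_right, hrest]

/-- Average over an entangling gate, in the Heisenberg picture. -/
theorem IsTwoDesign.exists_integral_onPair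
    {μ : Measure (Matrix.unitaryGroup (Fin q × Fin q) ℂ)} [IsProbabilityMeasure μ]
    (hμ : IsTwoDesign μ) {P Q : PairOp q} (hP : P ∈ Matrix.unitaryGroup (Fin q × Fin q) ℂ)
    (hQ : Q ∈ Matrix.unitaryGroup (Fin q × Fin q) ℂ) {i j : Fin n} (h : i ≠ j)
    (B : Fin n → PairOp q) :
    ∃ α β : ℂ,
      α * (q : ℂ) ^ 4 + β * (q : ℂ) ^ 2 = (B i).trace * (B j).trace ∧
      α * (q : ℂ) ^ 2 + β * (q : ℂ) ^ 4 = (swapOp _ * B i).trace * (swapOp _ * B j).trace ∧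
      ∀ L : Matrix ((Fin n → Fin q) × (Fin n → Fin q)) ((Fin n → Fin q) × (Fin n → Fin q)) ℂ →ₗ[ℂ]
          ℂ,
        ∫ V, L (conjCopies (onPair i j (P * V.1 * Q)) (tensorCopies B)) ∂μ =
          α * L (tensorCopies (setPair i j B 1)) +
            β * L (tensorCopies (setPair i j B (swapOp _))) := by
  obtain ⟨α, β, h1, h2, h3⟩ := hμ.exists_integral_conjCopies_mul hP hQ (pairCopies (B i) (B j))
  refine ⟨α, β, ?_, ?_, fun L => ?_⟩
  · rw [← trace_pairCopies, ← h1]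
    simp only [Fintype.card_prod, Fintype.card_fin, Nat.cast_mul]
    ring
  · rw [← trace_swapOp_mul_pairCopies, ← h2]
    simp only [Fintype.card_prod, Fintype.card_fin, Nat.cast_mul]
    ring
  · rw [tensorCopies_setPair h, tensorCopies_setPair h, pairCopies_one, pairCopies_swapOp,
      tensorCopies_eq_extendPair h]
    simp only [conjCopies_onPair h]
    exact h3 (L ∘ₗ extendPair i j (restCopies i j B))

end Pair

/-! ### Expectations in the biased random walk -/

section PMFExpectation

/-- The expectation of a complex-valued function on a finite type. -/
noncomputable def pmfExpect {α : Type*} [Fintype α] (P : PMF α) (f : α → ℂ) : ℂ :=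
  ∑ a, ((P a).toReal : ℂ) * f a

theorem pmfExpect_pure {α : Type*} [Fintype α] (a : α) (f : α → ℂ) :
    pmfExpect (PMF.pure a) f = f a := by
  classical
  rw [pmfExpect, Finset.sum_eq_single a]
  · simp [PMF.pure_apply]
  · intro b _ hb
    simp [PMF.pure_apply, hb]
  · simp

theorem pmfExpect_bind {α β : Type*} [Fintype α] [Fintype β] (P : PMF α) (g : α → PMF β)
    (f : β → ℂ) : pmfExpect (P.bind g) f = pmfExpect P fun a => pmfExpect (g a) f := by
  have h : ∀ b, ((P.bind g) b).toReal = ∑ a, (P a).toReal * (g a b).toReal := by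
    intro b
    rw [PMF.bind_apply, tsum_fintype, ENNReal.toReal_sum]
    · simp only [ENNReal.toReal_mul]
    · exact fun a _ => ENNReal.mul_ne_top (P.apply_ne_top a) ((g a).apply_ne_top b)
  simp only [pmfExpect, h, Complex.ofReal_sum, Complex.ofReal_mul, Finset.sum_mul, Finset.mul_sum]
  rw [Finset.sum_comm]
  simp only [mul_assoc]

theorem pmfExpect_map {α β : Type*} [Fintype α] [Fintype β] (P : PMF α) (g : α → β)
    (f : β → ℂ) : pmfExpect (P.map g) f = pmfExpect P fun a => f (g a) := by
  rw [PMF.map, pmfExpect_bind]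
  simp [pmfExpect_pure]

theorem toReal_toOuterMeasure_eq_pmfExpect {α : Type*} [Fintype α] (P : PMF α) (s : Set α) :
    ((P.toOuterMeasure s).toReal : ℂ) = pmfExpect P (s.indicator 1) := by
  classical
  rw [PMF.toOuterMeasure_apply_fintype, ENNReal.toReal_sum, Complex.ofReal_sum, pmfExpect]
  · refine Finset.sum_congr rfl fun a _ => ?_
    by_cases h : a ∈ s <;> simp [h]
  · intro a _
    by_cases h : a ∈ s <;> simp [h, P.apply_ne_top]

end PMFExpectation

/-! ### Product functions of the labels under the initial law and under one gate. -/

section Walk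

variable {n : ℕ}

theorem pmfExpect_labelLaw (d : ℕ) (f : Label → ℂ) :
    pmfExpect (labelLaw d) f = (f Label.S + d * f Label.I) / (d + 1) := by
  have h : (Finset.univ : Finset Label) = {Label.I, Label.S} := rfl
  have h1 : ((d : ℝ≥0∞) + 1).toReal = (d : ℝ) + 1 := by
    rw [ENNReal.toReal_add (by simp) (by simp)]
    simp
  rw [pmfExpect, h, Finset.sum_pair (by decide)]
  simp only [labelLaw, PMF.ofFintype_apply, ENNReal.toReal_div, h1, ENNReal.toReal_natCast,
    ENNReal.toReal_one]
  push_cast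
  ring

theorem pmfExpect_initialLaw (q : ℕ) (v : Fin n → Label → ℂ) :
    pmfExpect (initialLaw n q) (fun c => ∏ k, v k (c k)) =
      ∏ k, (v k Label.S + q * v k Label.I) / (q + 1) := by
  simp only [← pmfExpect_labelLaw]
  simp only [pmfExpect, Finset.prod_univ_sum, Fintype.piFinset_univ, initialLaw,
    PMF.ofFintype_apply, ENNReal.toReal_prod, Complex.ofReal_prod, Finset.prod_mul_distrib]

/-- The duality between one gate and one step. The hypotheses are the cases of two labels `I`, two
labels `S` and different labels; in the last case the step makes the labels equal, so only the
products `v i l * v j l` enter. -/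
theorem pmfExpect_gateStep {q : ℕ} {i j : Fin n} (h : i ≠ j) (v : Fin n → Label → ℂ)
    (wI wS : Label → ℂ) {α β : ℂ}
    (hII : α * wI .I * wI .I + β * wS .I * wS .I = v i .I * v j .I)
    (hSS : α * wI .S * wI .S + β * wS .S * wS .S = v i .S * v j .S)
    (hIS : (α * wI .I * wI .S + β * wS .I * wS .S) * ((q : ℂ) ^ 2 + 1) =
      v i .S * v j .S + (q : ℂ) ^ 2 * (v i .I * v j .I))
    (c : Fin n → Label) :
    pmfExpect (gateStep q (i, j) c) (fun c' => ∏ k, v k (c' k)) =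
      α * ∏ k, setPair i j v wI k (c k) + β * ∏ k, setPair i j v wS k (c k) := by
  have hrest : ∀ w : Label → ℂ,
      ∏ k : {k : Fin n // k ≠ i ∧ k ≠ j}, setPair i j v w k (c k) =
        ∏ k : {k : Fin n // k ≠ i ∧ k ≠ j}, v k (c k) := fun w =>
    Finset.prod_congr rfl fun k _ => by rw [setPair_of_ne k.2.1 k.2.2]
  have hrest' : ∀ l : Label,
      ∏ k : {k : Fin n // k ≠ i ∧ k ≠ j}, v k (setPair i j c l k) =
        ∏ k : {k : Fin n // k ≠ i ∧ k ≠ j}, v k (c k) := fun w =>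
    Finset.prod_congr rfl fun k _ => by rw [setPair_of_ne k.2.1 k.2.2]
  rw [prod_eq_mul_mul_prod_rest h fun k => setPair i j v wI k (c k),
    prod_eq_mul_mul_prod_rest h fun k => setPair i j v wS k (c k)]
  simp only [hrest, setPair_left, setPair_right]
  by_cases hc : c i = c j
  · rw [gateStep, if_pos hc, pmfExpect_pure, prod_eq_mul_mul_prod_rest h, hc]
    cases c j
    · linear_combination (-∏ k : {k : Fin n // k ≠ i ∧ k ≠ j}, v k (c k)) * hII
    · linear_combination (-∏ k : {k : Fin n // k ≠ i ∧ k ≠ j}, v k (c k)) * hSS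
  · have hq : ((q ^ 2 : ℕ) : ℂ) + 1 ≠ 0 := Nat.cast_add_one_ne_zero _
    rw [gateStep, if_neg hc, pmfExpect_map]
    have hset : ∀ l, ∏ k, v k (setPair i j c l k) =
        v i l * v j l * ∏ k : {k : Fin n // k ≠ i ∧ k ≠ j}, v k (c k) := fun l => by
      rw [prod_eq_mul_mul_prod_rest h, hrest', setPair_left, setPair_right]
    change pmfExpect _ (fun l => ∏ k, v k (setPair i j c l k)) = _
    simp only [hset]
    rw [pmfExpect_labelLaw, div_eq_iff hq]
    push_cast
    cases hi : c i <;> cases hj : c j <;> simp only [hi, hj, not_true_eq_false] at hc <;>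
      linear_combination (-∏ k : {k : Fin n // k ≠ i ∧ k ≠ j}, v k (c k)) * hIS

theorem pmfExpect_biasedWalk_zero (q : ℕ) (e : Fin 0 → Fin n × Fin n) (f : (Fin n → Label) → ℂ) :
    pmfExpect (biasedWalk n q 0 e) (fun γ => f (γ (Fin.last 0))) = pmfExpect (initialLaw n q) f := by
  rw [biasedWalk, pmfExpect_map]

theorem pmfExpect_biasedWalk_succ (q m : ℕ) (e : Fin (m + 1) → Fin n × Fin n)
    (f : (Fin n → Label) → ℂ) :
    pmfExpect (biasedWalk n q (m + 1) e) (fun γ => f (γ (Fin.last (m + 1)))) =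
      pmfExpect (biasedWalk n q m fun t => e t.castSucc) fun γ =>
        pmfExpect (gateStep q (e (Fin.last m)) (γ (Fin.last m))) f := by
  rw [biasedWalk, pmfExpect_bind]
  simp only [pmfExpect_map, Fin.snoc_last]

theorem pmfExpect_add_mul {α : Type*} [Fintype α] (P : PMF α) (f g : α → ℂ) (a b : ℂ) :
    pmfExpect P (fun x => a * f x + b * g x) = a * pmfExpect P f + b * pmfExpect P g := by
  simp only [pmfExpect, mul_add, Finset.sum_add_distrib, Finset.mul_sum]
  congr 1 <;> exact Finset.sum_congr rfl fun _ _ => by ring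

end Walk

/-! ### Unitarity and continuity of the circuit -/

section Circuit

variable {n q p : ℕ}

theorem exp_smul_mem {A : PairOp q} (hA : A.IsHermitian) (θ : ℝ) :
    NormedSpace.exp ((-(Complex.I * (θ : ℂ))) • A) ∈ Matrix.unitaryGroup (Fin q × Fin q) ℂ := by
  have h : ((-(Complex.I * (θ : ℂ))) • A)ᴴ = -((-(Complex.I * (θ : ℂ))) • A) := by
    rw [Matrix.conjTranspose_smul, hA.eq]
    simp
  have hc : Commute ((-(Complex.I * (θ : ℂ))) • A) (-((-(Complex.I * (θ : ℂ))) • A)) :=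
    (Commute.refl _).neg_right
  rw [Matrix.mem_unitaryGroup_iff, Matrix.star_eq_conjTranspose, ← Matrix.exp_conjTranspose, h,
    ← Matrix.exp_add_of_commute _ _ hc, add_neg_cancel,
    NormedSpace.exp_zero]

theorem ParamGate.toOp_mem (G : ParamGate q p) (θ : Fin p → ℝ) :
    G.toOp θ ∈ Matrix.unitaryGroup (Fin q × Fin q) ℂ :=
  mul_mem (mul_mem G.Wl.2 (exp_smul_mem G.hermitian _)) G.Wr.2

theorem ParamGate.continuous_toOp (G : ParamGate q p) : Continuous fun θ => G.toOp θ := by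
  have h : Continuous fun X : PairOp q => NormedSpace.exp X := by
    -- A norm is needed only to quote continuity of the exponential.
    open scoped Matrix.Norms.Operator in
    exact NormedSpace.exp_continuous
  unfold ParamGate.toOp
  exact (continuous_const.mul (h.comp (by fun_prop))).mul continuous_const

theorem timeOrdered_mem {M : Type*} [Monoid M] (S : Submonoid M) {l : List M}
    (h : ∀ a ∈ l, a ∈ S) : timeOrdered l ∈ S :=
  Submonoid.list_prod_mem _ fun a ha => h a (List.mem_reverse.mp ha)

theorem timeOrdered_map {M N F : Type*} [Monoid M] [Monoid N] [FunLike F M N] [MonoidHomClass F M N]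
    (f : F) (l : List M) : timeOrdered (l.map f) = f (timeOrdered l) := by
  rw [timeOrdered, timeOrdered, map_list_prod, List.map_reverse]

theorem continuous_timeOrdered {X ι M : Type*} [TopologicalSpace X] [TopologicalSpace M] [Monoid M]
    [ContinuousMul M] (f : ι → X → M) (hf : ∀ i, Continuous (f i)) (l : List ι) :
    Continuous fun x => timeOrdered (l.map fun i => f i x) := by
  simp only [timeOrdered, ← List.map_reverse]
  exact continuous_list_prod _ fun i _ => hf i

theorem continuous_onPair (i j : Fin n) : Continuous (onPair i j : PairOp q → Op n q) := by
  refine continuous_matrix fun s t => ?_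
  simp only [onPair, Matrix.of_apply]
  split_ifs
  · exact continuous_id.matrix_elem _ _
  · exact continuous_const

/-- `onPair` as a homomorphism. -/
noncomputable def onPairHom {i j : Fin n} (h : i ≠ j) : PairOp q →* Op n q where
  toFun := onPair i j
  map_one' := onPair_one h
  map_mul' A B := (onPair_mul h A B).symm

/-- The product of a list of parameterized gates as an operator on two qudits. -/
noncomputable def gatesOp (l : List (ParamGate q p)) (θ : Fin p → ℝ) : PairOp q :=
  timeOrdered (l.map fun G => G.toOp θ)

theorem gatesOp_mem (l : List (ParamGate q p)) (θ : Fin p → ℝ) :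
    gatesOp l θ ∈ Matrix.unitaryGroup (Fin q × Fin q) ℂ := by
  refine timeOrdered_mem _ fun a ha => ?_
  obtain ⟨G, -, rfl⟩ := List.mem_map.mp ha
  exact G.toOp_mem θ

theorem continuous_gatesOp (l : List (ParamGate q p)) : Continuous (gatesOp l) :=
  continuous_timeOrdered (fun G θ => G.toOp θ) (fun G => G.continuous_toOp) l

/-- All gates of a block act on the same pair, so the block is one two-site gate in which `V` stands
between fixed unitaries. -/
theorem Block.toOp_eq (B : Block n q p) (V : Matrix.unitaryGroup (Fin q × Fin q) ℂ)
    (θ : Fin p → ℝ) :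
    B.toOp V θ = onPair B.i B.j (gatesOp B.post θ * V.1 * gatesOp B.pre θ) := by
  have h : ∀ l : List (ParamGate q p), timeOrdered (l.map fun G => onPair B.i B.j (G.toOp θ)) =
      onPair B.i B.j (gatesOp l θ) := by
    intro l
    have := timeOrdered_map (onPairHom (n := n) B.ne) (l.map fun G => G.toOp θ)
    rwa [List.map_map] at this
  rw [Block.toOp, h, h, onPair_mul B.ne, onPair_mul B.ne]

theorem Block.toOp_mem (B : Block n q p) (V : Matrix.unitaryGroup (Fin q × Fin q) ℂ)
    (θ : Fin p → ℝ) : B.toOp V θ ∈ Matrix.unitaryGroup (Fin n → Fin q) ℂ := by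
  rw [B.toOp_eq]
  exact onPair_mem B.ne (mul_mem (mul_mem (gatesOp_mem _ _) V.2) (gatesOp_mem _ _))

theorem Block.continuous_toOp (B : Block n q p) {X : Type*} [TopologicalSpace X]
    {V : X → Matrix.unitaryGroup (Fin q × Fin q) ℂ} {θ : X → Fin p → ℝ} (hV : Continuous V)
    (hθ : Continuous θ) : Continuous fun x => B.toOp (V x) (θ x) := by
  simp only [B.toOp_eq]
  exact (continuous_onPair _ _).comp
    ((((continuous_gatesOp _).comp hθ).mul (continuous_subtype_val.comp hV)).mul
        ((continuous_gatesOp _).comp hθ))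

/-- The operator of a sequence of blocks. -/
noncomputable def blocksOp {m : ℕ} (b : Fin m → Block n q p)
    (V : Fin m → Matrix.unitaryGroup (Fin q × Fin q) ℂ) (θ : Fin p → ℝ) : Op n q :=
  timeOrdered (List.ofFn fun t => (b t).toOp (V t) θ)

theorem blocksOp_zero (b : Fin 0 → Block n q p)
    (V : Fin 0 → Matrix.unitaryGroup (Fin q × Fin q) ℂ) (θ : Fin p → ℝ) : blocksOp b V θ = 1 := by
  simp [blocksOp, timeOrdered]

theorem blocksOp_succ {m : ℕ} (b : Fin (m + 1) → Block n q p)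
    (V : Fin (m + 1) → Matrix.unitaryGroup (Fin q × Fin q) ℂ) (θ : Fin p → ℝ) :
    blocksOp b V θ = (b (Fin.last m)).toOp (V (Fin.last m)) θ *
      blocksOp (fun t => b t.castSucc) (fun t => V t.castSucc) θ := by
  rw [blocksOp, List.ofFn_succ', timeOrdered, List.concat_eq_append, List.reverse_append,
    List.reverse_singleton, List.singleton_append, List.prod_cons]
  rfl

theorem blocksOp_mem {m : ℕ} (b : Fin m → Block n q p)
    (V : Fin m → Matrix.unitaryGroup (Fin q × Fin q) ℂ) (θ : Fin p → ℝ) :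
    blocksOp b V θ ∈ Matrix.unitaryGroup (Fin n → Fin q) ℂ := by
  refine timeOrdered_mem _ fun a ha => ?_
  obtain ⟨t, rfl⟩ := (List.mem_ofFn' _ _).mp ha
  exact (b t).toOp_mem _ _

theorem continuous_blocksOp {m : ℕ} (b : Fin m → Block n q p) {X : Type*} [TopologicalSpace X]
    {V : X → Fin m → Matrix.unitaryGroup (Fin q × Fin q) ℂ} {θ : X → Fin p → ℝ}
    (hV : Continuous V) (hθ : Continuous θ) : Continuous fun x => blocksOp b (V x) (θ x) := by
  simp only [blocksOp, List.ofFn_eq_map]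
  exact continuous_timeOrdered (fun t x => (b t).toOp (V x t) (θ x))
    (fun t => (b t).continuous_toOp ((continuous_apply t).comp hV) hθ) _

/-! ### Average over the entangling gates -/

/-- The function of a label by which an operator on two copies of one site contributes to the
walk. -/
noncomputable def siteWeight (B : PairOp q) : Label → ℂ
  | .I => B.trace / (q : ℂ) ^ 2
  | .S => (swapOp _ * B).trace / q

theorem integral_pi_succ_last {m : ℕ} {X : Type*} [TopologicalSpace X] [CompactSpace X]
    [SecondCountableTopology X] [MeasurableSpace X] [BorelSpace X]
    (μ : Fin (m + 1) → Measure X) [∀ t, IsProbabilityMeasure (μ t)] {f : (Fin (m + 1) → X) → ℂ}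
    (hf : Continuous f) :
    ∫ V, f V ∂(Measure.pi μ) = ∫ V, ∫ x, f (Fin.snoc (α := fun _ => X) V x) ∂(μ (Fin.last m))
      ∂(Measure.pi fun t => μ t.castSucc) := by
  have hmp := (measurePreserving_piFinSuccAbove μ (Fin.last m)).symm
  have hint := hmp.integrable_comp_of_integrable (integrable_of_continuous (Measure.pi μ) hf)
  rw [← hmp.integral_comp']
  refine (integral_prod_symm _ hint).trans ?_
  simp only [Fin.succAbove_last]
  refine integral_congr_ae (Filter.Eventually.of_forall fun V => ?_)
  refine integral_congr_ae (Filter.Eventually.of_forall fun x => ?_)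
  change f (Fin.insertNth (Fin.last m) x V) = _
  rw [Fin.insertNth_last']

variable [NeZero q]

theorem continuous_conjCopies_apply {X ι : Type*} [TopologicalSpace X] [Fintype ι] [DecidableEq ι]
    {F : X → Matrix ι ι ℂ} (hF : Continuous F) (Y : Matrix (ι × ι) (ι × ι) ℂ) (s t : ι × ι) :
    Continuous fun x => conjCopies (F x) Y s t := by
  have h : ∀ a b, Continuous fun x => F x a b := fun a b => hF.matrix_elem a b
  simp only [conjCopies_entry]
  refine continuous_finsetSum _ fun y _ => continuous_finsetSum _ fun x _ => ?_
  exact ((((h _ _).mul (h _ _)).mul (h _ _).star).mul (h _ _).star).mul continuous_const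

/-- Induction that removes the last block, which acts first on the observable and last in the walk.
The disjunction in `hB` is what survives this removal: a site that no remaining block touches must
already satisfy the identity for the initial law. -/
theorem integral_blocksOp (θ : Fin p → ℝ) {m : ℕ} (b : Fin m → Block n q p)
    (μ : Fin m → Measure (Matrix.unitaryGroup (Fin q × Fin q) ℂ)) [∀ t, IsProbabilityMeasure (μ t)]
    (hμ : ∀ t, IsTwoDesign (μ t)) (B : Fin n → PairOp q)
    (hB : ∀ k, (∃ t, k = (b t).i ∨ k = (b t).j) ∨
      B k (0, 0) (0, 0) = (siteWeight (B k) .S + q * siteWeight (B k) .I) / (q + 1)) :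
    ∫ V, conjCopies (blocksOp b V θ) (tensorCopies B) (fun _ => 0, fun _ => 0)
        (fun _ => 0, fun _ => 0) ∂(Measure.pi μ) =
      pmfExpect (biasedWalk n q m fun t => ((b t).i, (b t).j))
        fun γ => ∏ k, siteWeight (B k) (γ (Fin.last m) k) := by
  have hq : (q : ℂ) ≠ 0 := Nat.cast_ne_zero.mpr (NeZero.ne q)
  have hq1 : (q : ℂ) + 1 ≠ 0 := Nat.cast_add_one_ne_zero q
  induction m generalizing B with
  | zero =>
    rw [pmfExpect_biasedWalk_zero q _ fun c => ∏ k, siteWeight (B k) (c k),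
      pmfExpect_initialLaw q fun k => siteWeight (B k)]
    simp only [blocksOp_zero, conjCopies_apply, Matrix.one_kronecker_one, Matrix.conjTranspose_one,
      one_mul, mul_one, integral_const, tensorCopies, Matrix.of_apply, probReal_univ, one_smul]
    refine Finset.prod_congr rfl fun k _ => ?_
    rcases hB k with ⟨t, -⟩ | h
    · exact t.elim0
    · exact h
  | succ m ih =>
    have hne := (b (Fin.last m)).ne
    set i := (b (Fin.last m)).i with hi
    set j := (b (Fin.last m)).j with hj
    have hcont : Continuous fun V => blocksOp b V θ :=
      continuous_blocksOp b continuous_id continuous_const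
    have hcont' : Continuous fun V => blocksOp (fun t => b t.castSucc) V θ :=
      continuous_blocksOp _ continuous_id continuous_const
    obtain ⟨α, β, h1, h2, h3⟩ := (hμ (Fin.last m)).exists_integral_onPair
      (gatesOp_mem (b (Fin.last m)).post θ) (gatesOp_mem (b (Fin.last m)).pre θ) hne B
    have hI1 : siteWeight (1 : PairOp q) .I = 1 := by
      simp only [siteWeight, Matrix.trace_one, Fintype.card_prod, Fintype.card_fin]
      push_cast
      field_simp
    have hI2 : siteWeight (1 : PairOp q) .S = 1 := by
      simp only [siteWeight, mul_one, trace_swapOp, Fintype.card_fin]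
      field_simp
    have hS1 : siteWeight (swapOp (Fin q)) .I = 1 / q := by
      simp only [siteWeight, trace_swapOp, Fintype.card_fin]
      field_simp
    have hS2 : siteWeight (swapOp (Fin q)) .S = q := by
      simp only [siteWeight, swapOp_mul_self, Matrix.trace_one, Fintype.card_prod, Fintype.card_fin]
      push_cast
      field_simp
    -- Sites `i` and `j` may lose their only block, but they now carry `1` or the swap, whose
    -- `(0,0)` entry `1` is the required mean.
    have hbase : ∀ D : PairOp q, (D = 1 ∨ D = swapOp _) → ∀ k,
        (∃ t : Fin m, k = (b t.castSucc).i ∨ k = (b t.castSucc).j) ∨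
          setPair i j B D k (0, 0) (0, 0) = (siteWeight (setPair i j B D k) .S +
            q * siteWeight (setPair i j B D k) .I) / (q + 1) := by
      intro D hD k
      have hDD : D (0, 0) (0, 0) = (siteWeight D .S + q * siteWeight D .I) / (q + 1) := by
        rcases hD with rfl | rfl
        · rw [hI1, hI2, Matrix.one_apply_eq, eq_div_iff hq1]
          ring
        · rw [hS1, hS2, swapOp_apply, eq_div_iff hq1]
          field_simp
          simp
      by_cases hki : k = i
      · rw [hki, setPair_left]; exact Or.inr hDD
      by_cases hkj : k = j
      · rw [hkj, setPair_right]; exact Or.inr hDD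
      rw [setPair_of_ne hki hkj]
      rcases hB k with ⟨t, ht⟩ | h
      · refine Or.inl ?_
        induction t using Fin.lastCases with
        | last => exact absurd ht (by tauto)
        | cast t => exact ⟨t, ht⟩
      · exact Or.inr h
    have hweights : ∀ D : PairOp q, (fun k => siteWeight (setPair i j B D k)) =
        setPair i j (fun k => siteWeight (B k)) (siteWeight D) := by
      intro D
      funext k
      by_cases hki : k = i
      · rw [hki, setPair_left, setPair_left]
      by_cases hkj : k = j
      · rw [hkj, setPair_right, setPair_right]
      rw [setPair_of_ne hki hkj, setPair_of_ne hki hkj]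
    have hstep : ∀ c : Fin n → Label,
        pmfExpect (gateStep q (i, j) c) (fun c' => ∏ k, siteWeight (B k) (c' k)) =
          α * ∏ k, siteWeight (setPair i j B 1 k) (c k) +
            β * ∏ k, siteWeight (setPair i j B (swapOp _) k) (c k) := by
      intro c
      -- These are the two trace equations divided by `q⁴` and `q²`. The condition for different
      -- labels is `e2 + q² * e1`, so `α` and `β` are never solved for and `q = 1` needs no separate
      -- treatment.
      have e1 : α + β / (q : ℂ) ^ 2 = siteWeight (B i) .I * siteWeight (B j) .I := by
        simp only [siteWeight]
        field_simp
        linear_combination h1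
      have e2 : α + β * (q : ℂ) ^ 2 = siteWeight (B i) .S * siteWeight (B j) .S := by
        simp only [siteWeight]
        field_simp
        linear_combination h2
      have := pmfExpect_gateStep (q := q) hne (fun k => siteWeight (B k)) (siteWeight 1)
        (siteWeight (swapOp _)) (α := α) (β := β)
        (by rw [hI1, hS1, ← e1]; field_simp)
        (by rw [hI2, hS2, ← e2]; ring)
        (by rw [hI1, hI2, hS1, hS2, ← e1, ← e2]; field_simp; ring) c
      rw [this, ← hweights, ← hweights]
    rw [pmfExpect_biasedWalk_succ q m _ fun c => ∏ k, siteWeight (B k) (c k)]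
    simp only [← hi, ← hj, hstep]
    rw [pmfExpect_add_mul,
      ← ih (fun t => b t.castSucc) (fun t => μ t.castSucc) (fun t => hμ _) _ (hbase _ (Or.inl rfl)),
      ← ih (fun t => b t.castSucc) (fun t => μ t.castSucc) (fun t => hμ _) _ (hbase _ (Or.inr rfl)),
      integral_pi_succ_last μ (continuous_conjCopies_apply hcont _ _ _),
      ← integral_const_mul, ← integral_const_mul, ← integral_add]
    · refine integral_congr_ae (Filter.Eventually.of_forall fun V => ?_)
      simp only [blocksOp_succ, Block.toOp_eq, Fin.snoc_last, Fin.snoc_castSucc, conjCopies_mul]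
      -- The functional conjugates by the earlier blocks and then reads off the `(0,0)` entry.
      exact h3 (Matrix.entryLinearMap ℂ ℂ _ _ ∘ₗ
        conjCopies (blocksOp (fun t => b t.castSucc) V θ))
    · exact (integrable_of_continuous _ (continuous_conjCopies_apply hcont' _ _ _)).const_mul _
    · exact (integrable_of_continuous _ (continuous_conjCopies_apply hcont' _ _ _)).const_mul _

end Circuit

/-! ### The average of the squared expectation value -/

section Average

variable {n q p m : ℕ}

instance (p : ℕ) : IsProbabilityMeasure (uniformParams p) := by
  have h : volume (Set.Icc (0 : Fin p → ℝ) fun _ => 2 * Real.pi) =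
      ∏ _ : Fin p, ENNReal.ofReal (2 * Real.pi) := by
    rw [Real.volume_Icc_pi]
    simp
  refine ProbabilityTheory.cond_isProbabilityMeasure_of_finite ?_ ?_
  · rw [h]
    exact Finset.prod_ne_zero_iff.mpr fun _ _ => (ENNReal.ofReal_pos.mpr Real.two_pi_pos).ne'
  · rw [h]
    exact ENNReal.prod_ne_top fun _ _ => ENNReal.ofReal_ne_top

/-- A bound uniform in the circuit, needed for Fubini because `θ` lives in the noncompact space
`ℝᵖ`. -/
theorem norm_conjTranspose_mul_mul_apply_le {ι : Type*} [Fintype ι] [DecidableEq ι]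
    {U : Matrix ι ι ℂ} (hU : U ∈ Matrix.unitaryGroup ι ℂ) (X : Matrix ι ι ℂ) (s t : ι) :
    ‖(Uᴴ * X * U) s t‖ ≤ ∑ y, ∑ x, ‖X x y‖ := by
  simp only [Matrix.mul_apply, Finset.sum_mul, Matrix.conjTranspose_apply]
  refine (norm_sum_le _ _).trans (Finset.sum_le_sum fun y _ => ?_)
  refine (norm_sum_le _ _).trans (Finset.sum_le_sum fun x _ => ?_)
  rw [norm_mul, norm_mul, norm_star]
  calc ‖U x s‖ * ‖X x y‖ * ‖U y t‖ ≤ 1 * ‖X x y‖ * 1 := by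
        gcongr
        · exact entry_norm_bound_of_unitary hU x s
        · exact entry_norm_bound_of_unitary hU y t
    _ = ‖X x y‖ := by ring

theorem Circuit.toOp_mem (C : Circuit n q p m)
    (V : Fin m → Matrix.unitaryGroup (Fin q × Fin q) ℂ) (θ : Fin p → ℝ) :
    C.toOp V θ ∈ Matrix.unitaryGroup (Fin n → Fin q) ℂ :=
  blocksOp_mem C.block V θ

theorem tensor_conjTranspose (B : Fin n → Matrix (Fin q) (Fin q) ℂ) :
    (tensor B)ᴴ = tensor fun k => (B k)ᴴ := by
  ext s t
  simp only [tensor, Matrix.conjTranspose_apply, Matrix.of_apply, star_prod]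

variable [NeZero q]

/-- Label `I` sees `|tr M a|² / q²`, which vanishes unless `a = 0` by orthogonality to `M 0 = 1`;
label `S` sees `tr (M a (M a)†) / q = 1`. -/
theorem IsOperatorBasis.siteWeight_apply {M : Fin (q ^ 2) → Matrix (Fin q) (Fin q) ℂ}
    (hM : IsOperatorBasis M) (a : Fin (q ^ 2)) (l : Label) :
    siteWeight (M a ⊗ₖ (M a)ᴴ) l = if a ≠ 0 → l = .S then 1 else 0 := by
  have hq : (q : ℂ) ≠ 0 := Nat.cast_ne_zero.mpr (NeZero.ne q)
  cases l
  · have h := hM.trace 0 a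
    rw [hM.zero, Matrix.conjTranspose_one, one_mul] at h
    rw [siteWeight, Matrix.trace_kronecker, Matrix.trace_conjTranspose, h]
    by_cases ha : a = 0
    · simp [ha]
      field_simp
    · simp [ha, Ne.symm ha]
  · rw [siteWeight, trace_swapOp_mul_kronecker, Matrix.trace_mul_comm, hM.trace]
    simp [hq]

theorem IsOperatorBasis.prod_siteWeight {M : Fin (q ^ 2) → Matrix (Fin q) (Fin q) ℂ}
    (hM : IsOperatorBasis M) (x : Fin n → Fin (q ^ 2)) (c : Fin n → Label) :
    ∏ k, siteWeight (M (x k) ⊗ₖ (M (x k))ᴴ) (c k) =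
      Set.indicator {c | supp x ⊆ sSites c} 1 c := by
  classical
  simp only [hM.siteWeight_apply, Finset.prod_ite_zero, Finset.prod_const_one, Finset.mem_univ,
    true_imp_iff, Set.indicator_apply, Set.mem_ofPred_eq, Pi.one_apply]
  exact if_congr Iff.rfl rfl rfl

theorem Circuit.star_expval (C : Circuit n q p m) (X : Op n q)
    (V : Fin m → Matrix.unitaryGroup (Fin q × Fin q) ℂ) (θ : Fin p → ℝ) :
    star (C.expval X V θ) = C.expval Xᴴ V θ := by
  rw [Circuit.expval, Circuit.expval, zeroExpectation, zeroExpectation,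
    ← Matrix.conjTranspose_apply, Matrix.conjTranspose_mul, Matrix.conjTranspose_mul,
    Matrix.conjTranspose_conjTranspose, mul_assoc]

/-- The conjugate of the expectation of `X` is that of `X†`, so no Hermiticity is needed. -/
theorem Circuit.norm_expval_sq (C : Circuit n q p m) (X : Op n q)
    (V : Fin m → Matrix.unitaryGroup (Fin q × Fin q) ℂ) (θ : Fin p → ℝ) :
    ((‖C.expval X V θ‖ ^ 2 : ℝ) : ℂ) =
      conjCopies (blocksOp C.block V θ) (X ⊗ₖ Xᴴ) (fun _ => 0, fun _ => 0)
        (fun _ => 0, fun _ => 0) := by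
  rw [conjCopies_kronecker, Matrix.kroneckerMap_apply]
  change _ = C.expval X V θ * C.expval Xᴴ V θ
  rw [← C.star_expval, Complex.star_def, Complex.mul_conj, Complex.normSq_eq_norm_sq]

theorem Circuit.walkProb_eq (C : Circuit n q p m) (x : Fin n → Fin (q ^ 2)) :
    (C.walkProb x : ℂ) = pmfExpect (biasedWalk n q m C.pairs) fun γ =>
      Set.indicator {c | supp x ⊆ sSites c} 1 (γ (Fin.last m)) := by
  rw [Circuit.walkProb, toReal_toOuterMeasure_eq_pmfExpect]
  rfl

/-- The second moment of the expectation value over the entangling gates, for fixed parameters. -/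
theorem Circuit.integral_norm_expval_sq (C : Circuit n q p m)
    (μ : Fin m → Measure (Matrix.unitaryGroup (Fin q × Fin q) ℂ)) [∀ t, IsProbabilityMeasure (μ t)]
    (hμ : ∀ t, IsTwoDesign (μ t)) {M : Fin (q ^ 2) → Matrix (Fin q) (Fin q) ℂ}
    (hM : IsOperatorBasis M) (x : Fin n → Fin (q ^ 2)) (θ : Fin p → ℝ) :
    ∫ V, ((‖C.expval (tensor fun k => M (x k)) V θ‖ ^ 2 : ℝ) : ℂ) ∂(Measure.pi μ) =
      C.walkProb x := by
  simp only [C.norm_expval_sq, tensor_conjTranspose, tensor_kronecker_tensor]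
  rw [integral_blocksOp θ C.block μ hμ _ fun k => Or.inl (C.covers k), C.walkProb_eq]
  simp only [hM.prod_siteWeight]
  rfl

theorem Circuit.integrable_norm_expval_sq (C : Circuit n q p m) (X : Op n q)
    (μ : Fin m → Measure (Matrix.unitaryGroup (Fin q × Fin q) ℂ))
    [∀ t, IsProbabilityMeasure (μ t)] :
    Integrable (Function.uncurry fun V (θ : Fin p → ℝ) => ((‖C.expval X V θ‖ ^ 2 : ℝ) : ℂ))
      ((Measure.pi μ).prod (uniformParams p)) := by
  have hcont : Continuous (Function.uncurry fun V (θ : Fin p → ℝ) =>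
      ((‖C.expval X V θ‖ ^ 2 : ℝ) : ℂ)) := by
    simp only [C.norm_expval_sq, Function.uncurry_def]
    exact continuous_conjCopies_apply
      (continuous_blocksOp C.block continuous_fst continuous_snd) _ _ _
  refine Integrable.of_bound hcont.aestronglyMeasurable ((∑ y, ∑ x, ‖X x y‖) ^ 2)
    (Filter.Eventually.of_forall fun z => ?_)
  simp only [Function.uncurry_def, Complex.norm_real, norm_pow, norm_norm]
  exact pow_le_pow_left₀ (norm_nonneg _)
    (norm_conjTranspose_mul_mul_apply_le (C.toOp_mem z.1 z.2) X _ _) 2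

/-- After Fubini the inner average over `V` does not depend on `θ`, and `θ` has a probability law.
-/
theorem Circuit.average_norm_expval_sq (C : Circuit n q p m)
    (μ : Fin m → Measure (Matrix.unitaryGroup (Fin q × Fin q) ℂ)) [∀ t, IsProbabilityMeasure (μ t)]
    (hμ : ∀ t, IsTwoDesign (μ t)) {M : Fin (q ^ 2) → Matrix (Fin q) (Fin q) ℂ}
    (hM : IsOperatorBasis M) (x : Fin n → Fin (q ^ 2)) :
    average μ (fun V (θ : Fin p → ℝ) =>
      ((‖C.expval (tensor fun k => M (x k)) V θ‖ ^ 2 : ℝ) : ℂ)) = C.walkProb x := by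
  rw [average, integral_integral_swap (C.integrable_norm_expval_sq _ μ)]
  simp only [C.integral_norm_expval_sq μ hμ hM x, integral_const, probReal_univ, one_smul]

theorem Circuit.expval_sq_of_isHermitian (C : Circuit n q p m) {X : Op n q} (hX : X.IsHermitian)
    (V : Fin m → Matrix.unitaryGroup (Fin q × Fin q) ℂ) (θ : Fin p → ℝ) :
    C.expval X V θ ^ 2 = ((‖C.expval X V θ‖ ^ 2 : ℝ) : ℂ) := by
  have h := C.star_expval X V θ
  rw [hX.eq, Complex.star_def] at h
  rw [← Complex.normSq_eq_norm_sq, ← Complex.mul_conj, h, sq]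

end Average

end HEA

theorem theorem1 {n q p m : ℕ} [NeZero q]
    (C : HEA.Circuit n q p m)
    (μ : Fin m → MeasureTheory.Measure (Matrix.unitaryGroup (Fin q × Fin q) ℂ))
    [∀ t, MeasureTheory.IsProbabilityMeasure (μ t)]
    (hμ : ∀ t, HEA.IsTwoDesign (μ t))
    (M : Fin (q ^ 2) → Matrix (Fin q) (Fin q) ℂ)
    (hM : HEA.IsOperatorBasis M)
    (x : Fin n → Fin (q ^ 2)) :
    HEA.average μ (fun V (θ : Fin p → ℝ) =>
        ‖C.expval (HEA.tensor fun k => M (x k)) V θ‖ ^ 2) = C.walkProb x ∧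
      ((∀ k, (M k).IsHermitian) →
        HEA.average μ (fun V (θ : Fin p → ℝ) =>
          (C.expval (HEA.tensor fun k => M (x k)) V θ) ^ 2) = (C.walkProb x : ℂ)) := by
  refine ⟨?_, fun hHerm => ?_⟩
  -- The real average is compared with the complex one by moving the coercion through both
  -- integrals.
  · rw [← Complex.ofReal_inj, ← C.average_norm_expval_sq μ hμ hM x, HEA.average, HEA.average,
      ← integral_complex_ofReal]
    simp only [integral_complex_ofReal]
  · have hX : (HEA.tensor fun k => M (x k)).IsHermitian := by
      rw [Matrix.IsHermitian, HEA.tensor_conjTranspose]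
      simp only [(hHerm _).eq]
    simp only [C.expval_sq_of_isHermitian hX]
    exact C.average_norm_expval_sq μ hμ hM x
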